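/- Let $\mathcal{G}=(G^0,\mathcal{G}^1,r,s)$ be an ultragraph, that is, sets $G^0$ (vertices) and $\mathcal{G}^1$ (edges) of arbitrary cardinality with maps $s:\mathcal{G}^1\to G^0$ and $r:\mathcal{G}^1\to P(G^0)\setminus\{\emptyset\}$. Let $\mathcal{G}^0\subseteq P(G^0)$ be the smallest family containing $\emptyset$, all $\{v\}$ ($v\in G^0$) and all $r(e)$ ($e\in\mathcal{G}^1$), and closed under finite unions and nonempty finite intersections. Let $R$ be a unital commutative ring. The Leavitt path algebra $L_R(\mathcal{G})$ is the universal (associative, not necessarily unital) $R$-algebra with generators $s_e,s_e^*$ $(e\in\mathcal{G}^1)$ and $p_A$ $(A\in\mathcal{G}^0)$ and relations 1. $p_\emptyset=0$, $p_Ap_B=p_{A\cap B}$, $p_{A\cup B}=p_A+p_B-p_{A\cap B}$ for all $A,B\in\mathcal{G}^0$; 2. $p_{\{s(e)\}}s_e=s_ep_{r(e)}=s_e$ and $p_{r(e)}s_e^*=s_e^*p_{\{s(e)\}}=s_e^*$ for all $e\in\mathcal{G}^1$; 3. $s_e^*s_f=\delta_{e,f}\,p_{r(e)}$ for all $e,f\in\mathcal{G}^1$;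 4. $p_{\{v\}}=\sum_{s(e)=v}s_es_e^*$ whenever $0<|s^{-1}(v)|<\infty$. A closed path is a sequence of edges $\alpha=\alpha_1\cdots\alpha_n$ with $n\ge 1$, $s(\alpha_{i+1})\in r(\alpha_i)$ for $1\le i<n$, and $s(\alpha_1)\in r(\alpha_n)$. An exit for $\alpha$ is either an edge $e$ such that, for some $1\le i\le n$, $s(e)\in r(\alpha_i)$ and $e\ne\alpha_{i+1}$ (where $\alpha_{n+1}:=\alpha_1$), or a vertex $w$ with $s^{-1}(w)=\emptyset$ and $w\in r(\alpha_i)$ for some $i$. The ultragraph satisfies Condition (L) if every closed path has an exit. A $\mathcal{G}$-algebraic branching system on a set $X$ is a family $\{R_e,D_A,f_e\}_{e\in\mathcal{G}^1,A\in\mathcal{G}^0}$ with $R_e,D_A\subseteq X$ such that: $R_e\cap R_f=\emptyset$ for $e\neq f$; $D_\emptyset=\emptyset$, $D_A\cap D_B=D_{A\cap B}$ and $D_A\cup D_B=D_{A\cup B}$ for all $A,B\in\mathcal{G}^0$; $R_e\subseteq D_{\{s(e)\}}$ for all $e$; $D_{\{v\}}=\bigcup_{s(e)=v}R_e$ whenever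 $0<|s^{-1}(v)|<\infty$; and each $f_e:D_{r(e)}\to R_e$ is a bijection. Let $M$ be the $R$-module of all maps $X\to R$. The representation induced by the branching system is the unique homomorphism of $R$-algebras $\pi:L_R(\mathcal{G})\to \mathrm{Hom}_R(M)$ into the algebra of $R$-linear endomorphisms of $M$ such that, for $\phi\in M$, $$\pi(s_e)(\phi)=(\phi\circ f_e^{-1})\cdot 1_{R_e},\qquad \pi(s_e^*)(\phi)=(\phi\circ f_e)\cdot 1_{D_{r(e)}},\qquad \pi(p_A)(\phi)=1_{D_A}\cdot\phi,$$ where the products are extended by $0$ outside $R_e$, respectively $D_{r(e)}$. **Theorem.** If $\mathcal{G}$ satisfies Condition (L), then for every set $X$ and every $\mathcal{G}$-algebraic branching system on $X$ with $D_A\neq\emptyset$ for all nonempty $A\in\mathcal{G}^0$, the induced representation $\pi$ of $L_R(\mathcal{G})$ is faithful (injective). -/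

import Mathlib

/-- An ultragraph `(G⁰, 𝒢¹, r, s)`: vertices `V`, edges `E`, a source map with values in `V` and a
range map with values in the nonempty subsets of `V`. No countability is assumed. -/
structure Ultragraph (V : Type*) (E : Type*) where
  source : E → V
  range : E → Set V
  range_nonempty : ∀ e, (range e).Nonempty

namespace Ultragraph

section Combinatorics

variable {V E : Type*} (G : Ultragraph V E)

/-- Membership in `𝒢⁰`, the smallest family of subsets of `V` that contains `∅`, the singletons
and the ranges of edges, and is closed under (binary) unions and intersections. -/
inductive IsGenVertex : Set V → Prop
  | empty : IsGenVertex ∅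
  | singleton (v : V) : IsGenVertex {v}
  | range (e : E) : IsGenVertex (G.range e)
  | union {A B : Set V} : IsGenVertex A → IsGenVertex B → IsGenVertex (A ∪ B)
  | inter {A B : Set V} : IsGenVertex A → IsGenVertex B → IsGenVertex (A ∩ B)

/-- The type `𝒢⁰` of generalized vertices. -/
def GenVertex : Type _ := {A : Set V // G.IsGenVertex A}

namespace GenVertex

variable {G}

/-- The set of vertices underlying a generalized vertex. -/
def carrier (A : G.GenVertex) : Set V := A.1

variable (G) in
/-- `∅ ∈ 𝒢⁰`. -/
def empty : G.GenVertex := ⟨∅, .empty⟩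

variable (G) in
/-- `{v} ∈ 𝒢⁰`. -/
def vertex (v : V) : G.GenVertex := ⟨{v}, .singleton v⟩

variable (G) in
/-- `r(e) ∈ 𝒢⁰`. -/
def ofRange (e : E) : G.GenVertex := ⟨G.range e, .range e⟩

/-- `A ∪ B ∈ 𝒢⁰`. -/
def union (A B : G.GenVertex) : G.GenVertex := ⟨A.1 ∪ B.1, .union A.2 B.2⟩

/-- `A ∩ B ∈ 𝒢⁰`. -/
def inter (A B : G.GenVertex) : G.GenVertex := ⟨A.1 ∩ B.1, .inter A.2 B.2⟩

end GenVertex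

/-- A sink: a vertex that emits no edge. -/
def IsSink (v : V) : Prop := ∀ e, G.source e ≠ v

/-- The sequence of edges `α₀ α₁ … αₙ` (of length `n + 1 ≥ 1`) is a path. -/
def IsPath {n : ℕ} (α : Fin (n + 1) → E) : Prop :=
  ∀ i : Fin n, G.source (α i.succ) ∈ G.range (α i.castSucc)

/-- A closed path: a path `α` of length at least one with `s(α) ∈ r(α)`. -/
def IsClosedPath {n : ℕ} (α : Fin (n + 1) → E) : Prop :=
  G.IsPath α ∧ G.source (α 0) ∈ G.range (α (Fin.last n))

/-- A closed path has an exit: an edge `e` with `s(e) ∈ r(αᵢ)` and `e ≠ αᵢ₊₁`, or a sink in some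
`r(αᵢ)`. Indices are cyclic: addition in `Fin (n + 1)` wraps around, so after the last edge of the
closed path comes the first one. -/
def HasExit {n : ℕ} (α : Fin (n + 1) → E) : Prop :=
  (∃ (e : E) (i : Fin (n + 1)), G.source e ∈ G.range (α i) ∧ e ≠ α (i + 1)) ∨
    ∃ (w : V) (i : Fin (n + 1)), G.IsSink w ∧ w ∈ G.range (α i)

/-- Condition (L): every closed path has an exit. -/
def ConditionL : Prop :=
  ∀ (n : ℕ) (α : Fin (n + 1) → E), G.IsClosedPath α → G.HasExit α

end Combinatorics

section Algebra

variable {V E : Type*} (G : Ultragraph V E)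

/-- The generators `s_e`, `s_e^*`, `p_A` of the ultragraph Leavitt path algebra. -/
inductive Gen
  | s (e : E) : Gen
  | sStar (e : E) : Gen
  | p (A : G.GenVertex) : Gen

/-- The defining relations of the ultragraph Leavitt path algebra, for a family
`s_e`, `s_e^*`, `p_A` of elements of a (not necessarily unital) ring. -/
structure IsLeavittFamily {B : Type*} [NonUnitalRing B]
    (s sStar : E → B) (p : G.GenVertex → B) : Prop where
  p_empty : p (GenVertex.empty G) = 0
  p_mul_p : ∀ A C : G.GenVertex, p A * p C = p (A.inter C)
  p_union : ∀ A C : G.GenVertex, p (A.union C) = p A + p C - p (A.inter C)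
  p_source_mul_s : ∀ e, p (GenVertex.vertex G (G.source e)) * s e = s e
  s_mul_p_range : ∀ e, s e * p (GenVertex.ofRange G e) = s e
  p_range_mul_sStar : ∀ e, p (GenVertex.ofRange G e) * sStar e = sStar e
  sStar_mul_p_source : ∀ e, sStar e * p (GenVertex.vertex G (G.source e)) = sStar e
  sStar_mul_s_self : ∀ e, sStar e * s e = p (GenVertex.ofRange G e)
  sStar_mul_s_of_ne : ∀ e f, e ≠ f → sStar e * s f = 0
  p_vertex : ∀ (v : V) (hv : {e | G.source e = v}.Finite), {e | G.source e = v}.Nonempty →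
    p (GenVertex.vertex G v) = ∑ e ∈ hv.toFinset, s e * sStar e

variable (R : Type*) [CommRing R]

/-- The free associative non-unital `R`-algebra on the generators: the semigroup algebra of the
free semigroup on them. -/
abbrev FreeAlg : Type _ := MonoidAlgebra R (FreeSemigroup G.Gen)

variable {G} in
/-- A generator, as an element of the free algebra. -/
noncomputable def FreeAlg.gen (x : G.Gen) : G.FreeAlg R :=
  MonoidAlgebra.single (FreeSemigroup.of x) 1

/-- The congruence defining `L_R(𝒢)`: the smallest `R`-algebra congruence on the free algebra
modulo which the generators satisfy the defining relations. -/
noncomputable def leavittCon : RingCon (G.FreeAlg R) :=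
  sInf {c | (∀ (r : R) (x y : G.FreeAlg R), c x y → c (r • x) (r • y)) ∧
    G.IsLeavittFamily (B := c.Quotient)
      (fun e => ((FreeAlg.gen R (.s e) : G.FreeAlg R) : c.Quotient))
      (fun e => ((FreeAlg.gen R (.sStar e) : G.FreeAlg R) : c.Quotient))
      (fun A => ((FreeAlg.gen R (.p A) : G.FreeAlg R) : c.Quotient))}

/-- The ultragraph Leavitt path algebra `L_R(𝒢)`: the universal (associative, not necessarily
unital) `R`-algebra generated by a Leavitt family. -/
def LeavittPathAlgebra : Type _ := (G.leavittCon R).Quotient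

noncomputable instance : NonUnitalRing (G.LeavittPathAlgebra R) :=
  inferInstanceAs (NonUnitalRing (G.leavittCon R).Quotient)

theorem leavittCon_smul (r : R) {x y : G.FreeAlg R} (h : G.leavittCon R x y) :
    G.leavittCon R (r • x) (r • y) := by
  intro c hc
  exact hc.1 r x y (h c hc)

variable {R} in
/-- The quotient map from the free algebra to `L_R(𝒢)`. -/
noncomputable def LeavittPathAlgebra.mk (x : G.FreeAlg R) : G.LeavittPathAlgebra R :=
  (x : (G.leavittCon R).Quotient)

namespace LeavittPathAlgebra

variable {G R}

theorem mk_surjective : Function.Surjective (mk G (R := R)) := Quotient.mk''_surjective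

theorem mk_eq_mk {x y : G.FreeAlg R} : mk G x = mk G y ↔ G.leavittCon R x y :=
  (G.leavittCon R).eq

theorem mk_zero : mk G (0 : G.FreeAlg R) = 0 := rfl

theorem mk_add (x y : G.FreeAlg R) : mk G (x + y) = mk G x + mk G y := rfl

theorem mk_sub (x y : G.FreeAlg R) : mk G (x - y) = mk G x - mk G y := rfl

theorem mk_mul (x y : G.FreeAlg R) : mk G (x * y) = mk G x * mk G y := rfl

noncomputable instance : SMul R (G.LeavittPathAlgebra R) where
  smul r := Quotient.map' (fun x => r • x) fun _ _ h => G.leavittCon_smul R r h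

theorem mk_smul (r : R) (x : G.FreeAlg R) : mk G (r • x) = r • mk G x := rfl

noncomputable instance : Module R (G.LeavittPathAlgebra R) where
  one_smul x := by
    obtain ⟨x, rfl⟩ := mk_surjective x
    rw [← mk_smul, one_smul]
  mul_smul r t x := by
    obtain ⟨x, rfl⟩ := mk_surjective x
    simp only [← mk_smul, mul_smul]
  smul_zero r := by rw [← mk_zero, ← mk_smul, smul_zero]
  smul_add r x y := by
    obtain ⟨x, rfl⟩ := mk_surjective x
    obtain ⟨y, rfl⟩ := mk_surjective y
    simp only [← mk_smul, ← mk_add, smul_add]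
  add_smul r t x := by
    obtain ⟨x, rfl⟩ := mk_surjective x
    simp only [← mk_smul, ← mk_add, add_smul]
  zero_smul x := by
    obtain ⟨x, rfl⟩ := mk_surjective x
    rw [← mk_smul, zero_smul, mk_zero]

instance : IsScalarTower R (G.LeavittPathAlgebra R) (G.LeavittPathAlgebra R) where
  smul_assoc r x y := by
    obtain ⟨x, rfl⟩ := mk_surjective x
    obtain ⟨y, rfl⟩ := mk_surjective y
    simp only [smul_eq_mul, ← mk_smul, ← mk_mul, smul_mul_assoc]

instance : SMulCommClass R (G.LeavittPathAlgebra R) (G.LeavittPathAlgebra R) where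
  smul_comm r x y := by
    obtain ⟨x, rfl⟩ := mk_surjective x
    obtain ⟨y, rfl⟩ := mk_surjective y
    simp only [smul_eq_mul, ← mk_smul, ← mk_mul, mul_smul_comm]

variable (G R) in
/-- The generator `s_e`. -/
noncomputable def s (e : E) : G.LeavittPathAlgebra R := mk G (FreeAlg.gen R (.s e))

variable (G R) in
/-- The generator `s_e^*`. -/
noncomputable def sStar (e : E) : G.LeavittPathAlgebra R := mk G (FreeAlg.gen R (.sStar e))

variable (G R) in
/-- The generator `p_A`. -/
noncomputable def p (A : G.GenVertex) : G.LeavittPathAlgebra R := mk G (FreeAlg.gen R (.p A))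

theorem mk_sum {ι : Type*} (t : Finset ι) (f : ι → G.FreeAlg R) :
    mk G (∑ i ∈ t, f i) = ∑ i ∈ t, mk G (f i) :=
  map_sum (⟨⟨mk G, mk_zero⟩, mk_add⟩ : G.FreeAlg R →+ G.LeavittPathAlgebra R) f t

theorem coe_sum (c : RingCon (G.FreeAlg R)) {ι : Type*} (t : Finset ι) (f : ι → G.FreeAlg R) :
    ((∑ i ∈ t, f i : G.FreeAlg R) : c.Quotient) = ∑ i ∈ t, (f i : c.Quotient) :=
  map_sum (⟨⟨fun x => (x : c.Quotient), rfl⟩, fun _ _ => rfl⟩ : G.FreeAlg R →+ c.Quotient) f t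

variable (G R) in
/-- The generators of `L_R(𝒢)` satisfy the defining relations. -/
theorem isLeavittFamily : G.IsLeavittFamily (s G R) (sStar G R) (p G R) where
  p_empty := mk_eq_mk.2 fun c hc => c.eq.1 hc.2.p_empty
  p_mul_p A C := mk_eq_mk.2 fun c hc => c.eq.1 (hc.2.p_mul_p A C)
  p_union A C := mk_eq_mk.2 fun c hc => c.eq.1 (hc.2.p_union A C)
  p_source_mul_s e := mk_eq_mk.2 fun c hc => c.eq.1 (hc.2.p_source_mul_s e)
  s_mul_p_range e := mk_eq_mk.2 fun c hc => c.eq.1 (hc.2.s_mul_p_range e)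
  p_range_mul_sStar e := mk_eq_mk.2 fun c hc => c.eq.1 (hc.2.p_range_mul_sStar e)
  sStar_mul_p_source e := mk_eq_mk.2 fun c hc => c.eq.1 (hc.2.sStar_mul_p_source e)
  sStar_mul_s_self e := mk_eq_mk.2 fun c hc => c.eq.1 (hc.2.sStar_mul_s_self e)
  sStar_mul_s_of_ne e f h := mk_eq_mk.2 fun c hc => c.eq.1 (hc.2.sStar_mul_s_of_ne e f h)
  p_vertex v hv hne := by
    simp only [s, sStar, p, ← mk_mul, ← mk_sum]
    refine mk_eq_mk.2 fun c hc => c.eq.1 ?_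
    rw [hc.2.p_vertex v hv hne, coe_sum]
    rfl

variable {B : Type*} [NonUnitalRing B] [Module R B] [IsScalarTower R B B] [SMulCommClass R B B]

variable (R) in
/-- The map from the free algebra determined by the images of the generators. -/
noncomputable def freeLift (f : G.Gen → B) : G.FreeAlg R →ₙₐ[R] B :=
  MonoidAlgebra.liftMagma R (FreeSemigroup.lift f)

theorem freeLift_gen (f : G.Gen → B) (x : G.Gen) :
    freeLift R f (FreeAlg.gen R x) = f x := by
  simp [freeLift, FreeAlg.gen]

/-- The assignment of images to the generators. -/
def genMap (S T : E → B) (P : G.GenVertex → B) : G.Gen → B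
  | .s e => S e
  | .sStar e => T e
  | .p A => P A

theorem freeLift_rel {S T : E → B} {P : G.GenVertex → B} (h : G.IsLeavittFamily S T P)
    {x y : G.FreeAlg R} (hxy : G.leavittCon R x y) :
    freeLift R (genMap S T P) x = freeLift R (genMap S T P) y := by
  let φ := freeLift R (genMap S T P)
  let c : RingCon (G.FreeAlg R) :=
    { r := fun x y => φ x = φ y
      iseqv := ⟨fun _ => rfl, fun h => h.symm, fun h₁ h₂ => h₁.trans h₂⟩
      add' := fun {a b c d} h₁ h₂ => by
        rw [map_add, map_add]
        exact congrArg₂ _ h₁ h₂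
      mul' := fun {a b c d} h₁ h₂ => by
        rw [map_mul, map_mul]
        exact congrArg₂ _ h₁ h₂ }
  refine hxy c ⟨fun r x y (hxy : φ x = φ y) => ?_, ?_⟩
  · change φ (r • x) = φ (r • y)
    rw [map_smul, map_smul, hxy]
  have hs : ∀ e, φ (FreeAlg.gen R (.s e)) = S e := fun e => freeLift_gen _ _
  have ht : ∀ e, φ (FreeAlg.gen R (.sStar e)) = T e := fun e => freeLift_gen _ _
  have hp : ∀ A, φ (FreeAlg.gen R (.p A)) = P A := fun A => freeLift_gen _ _
  have key : ∀ {x y : G.FreeAlg R}, φ x = φ y → (x : c.Quotient) = (y : c.Quotient) :=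
    fun h => c.eq.2 h
  constructor
  · exact key (y := 0) (by rw [hp, map_zero, h.p_empty])
  · intro A C
    exact key (x := _ * _) (by rw [map_mul, hp, hp, hp, h.p_mul_p])
  · intro A C
    exact key (y := _ + _ - _) (by rw [map_sub, map_add, hp, hp, hp, hp, h.p_union])
  · intro e
    exact key (x := _ * _) (by rw [map_mul, hp, hs, h.p_source_mul_s])
  · intro e
    exact key (x := _ * _) (by rw [map_mul, hp, hs, h.s_mul_p_range])
  · intro e
    exact key (x := _ * _) (by rw [map_mul, hp, ht, h.p_range_mul_sStar])
  · intro e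
    exact key (x := _ * _) (by rw [map_mul, hp, ht, h.sStar_mul_p_source])
  · intro e
    exact key (x := _ * _) (by rw [map_mul, hp, ht, hs, h.sStar_mul_s_self])
  · intro e f hef
    exact key (x := _ * _) (y := 0) (by rw [map_mul, ht, hs, map_zero, h.sStar_mul_s_of_ne e f hef])
  · intro v hv hne
    refine (key (y := ∑ e ∈ hv.toFinset, FreeAlg.gen R (.s e) * FreeAlg.gen R (.sStar e)) ?_).trans
      (coe_sum c _ _)
    rw [hp, map_sum, h.p_vertex v hv hne]
    exact Finset.sum_congr rfl fun e _ => by rw [map_mul, hs, ht]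

variable (R) in
/-- The universal property of `L_R(𝒢)`: a family in an `R`-algebra that satisfies the defining
relations induces a homomorphism. -/
noncomputable def lift {S T : E → B} {P : G.GenVertex → B} (h : G.IsLeavittFamily S T P) :
    G.LeavittPathAlgebra R →ₙₐ[R] B where
  toFun x := Quotient.liftOn' x (freeLift R (genMap S T P)) fun _ _ hxy => freeLift_rel h hxy
  map_smul' r x := by
    obtain ⟨x, rfl⟩ := mk_surjective x
    exact map_smul (freeLift R (genMap S T P)) r x
  map_zero' := map_zero (freeLift R (genMap S T P))
  map_add' x y := by
    obtain ⟨x, rfl⟩ := mk_surjective x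
    obtain ⟨y, rfl⟩ := mk_surjective y
    exact map_add (freeLift R (genMap S T P)) x y
  map_mul' x y := by
    obtain ⟨x, rfl⟩ := mk_surjective x
    obtain ⟨y, rfl⟩ := mk_surjective y
    exact map_mul (freeLift R (genMap S T P)) x y

theorem lift_s {S T : E → B} {P : G.GenVertex → B} (h : G.IsLeavittFamily S T P) (e : E) :
    lift R h (s G R e) = S e := freeLift_gen _ _

theorem lift_sStar {S T : E → B} {P : G.GenVertex → B} (h : G.IsLeavittFamily S T P) (e : E) :
    lift R h (sStar G R e) = T e := freeLift_gen _ _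

theorem lift_p {S T : E → B} {P : G.GenVertex → B} (h : G.IsLeavittFamily S T P)
    (A : G.GenVertex) : lift R h (p G R A) = P A := freeLift_gen _ _

/-- A homomorphism out of `L_R(𝒢)` is determined by its values on the generators. -/
theorem hom_ext {φ ψ : G.LeavittPathAlgebra R →ₙₐ[R] B}
    (hs : ∀ e, φ (s G R e) = ψ (s G R e)) (ht : ∀ e, φ (sStar G R e) = ψ (sStar G R e))
    (hp : ∀ A, φ (p G R A) = ψ (p G R A)) : φ = ψ := by
  let q : G.FreeAlg R →ₙₐ[R] G.LeavittPathAlgebra R :=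
    { toFun := mk G, map_smul' := mk_smul, map_zero' := mk_zero, map_add' := mk_add,
      map_mul' := mk_mul }
  have hq : φ.comp q = ψ.comp q := by
    refine MonoidAlgebra.nonUnitalAlgHom_ext' R (FreeSemigroup.hom_ext (funext fun x => ?_))
    cases x with
    | s e => exact hs e
    | sStar e => exact ht e
    | p A => exact hp A
  ext x
  obtain ⟨x, rfl⟩ := mk_surjective x
  exact DFunLike.congr_fun hq x

end LeavittPathAlgebra

end Algebra

/-- A `𝒢`-algebraic branching system `{R_e, D_A, f_e}` on the set `X`. The bijection
`f_e : D_{r(e)} → R_e` and its inverse are bundled as an equivalence. -/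
structure BranchingSystem {V E : Type*} (G : Ultragraph V E) (X : Type*) where
  R : E → Set X
  D : G.GenVertex → Set X
  f : ∀ e, D (GenVertex.ofRange G e) ≃ R e
  R_inter : ∀ e e', e ≠ e' → R e ∩ R e' = ∅
  D_empty : D (GenVertex.empty G) = ∅
  D_inter : ∀ A B : G.GenVertex, D A ∩ D B = D (A.inter B)
  D_union : ∀ A B : G.GenVertex, D A ∪ D B = D (A.union B)
  R_subset : ∀ e, R e ⊆ D (GenVertex.vertex G (G.source e))
  D_vertex : ∀ v : V, {e | G.source e = v}.Finite → {e | G.source e = v}.Nonempty →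
    D (GenVertex.vertex G v) = ⋃ e ∈ {e | G.source e = v}, R e

namespace BranchingSystem

variable {V E X : Type*} {G : Ultragraph V E} (S : G.BranchingSystem X)
variable (K : Type*) [CommRing K]

open Classical in
/-- `S_e(φ) = (φ ∘ f_e⁻¹) · 1_{R_e}` on the module of all functions `X → K`. -/
noncomputable def opS (e : E) : Module.End K (X → K) where
  toFun φ x := if h : x ∈ S.R e then φ ((S.f e).symm ⟨x, h⟩) else 0
  map_add' φ ψ := by
    funext x
    by_cases h : x ∈ S.R e <;> simp [h]
  map_smul' r φ := by
    funext x
    by_cases h : x ∈ S.R e <;> simp [h]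

open Classical in
/-- `S_e^*(φ) = (φ ∘ f_e) · 1_{D_{r(e)}}` on the module of all functions `X → K`. -/
noncomputable def opSStar (e : E) : Module.End K (X → K) where
  toFun φ x := if h : x ∈ S.D (GenVertex.ofRange G e) then φ (S.f e ⟨x, h⟩) else 0
  map_add' φ ψ := by
    funext x
    by_cases h : x ∈ S.D (GenVertex.ofRange G e) <;> simp [h]
  map_smul' r φ := by
    funext x
    by_cases h : x ∈ S.D (GenVertex.ofRange G e) <;> simp [h]

open Classical in
/-- `P_A(φ) = φ · 1_{D_A}` on the module of all functions `X → K`. -/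
noncomputable def opP (A : G.GenVertex) : Module.End K (X → K) where
  toFun φ x := if x ∈ S.D A then φ x else 0
  map_add' φ ψ := by
    funext x
    by_cases h : x ∈ S.D A <;> simp [h]
  map_smul' r φ := by
    funext x
    by_cases h : x ∈ S.D A <;> simp [h]

open Classical in
theorem opS_mul_opSStar_apply (e : E) (φ : X → K) (x : X) :
    (S.opS K e * S.opSStar K e) φ x = if x ∈ S.R e then φ x else 0 := by
  by_cases h : x ∈ S.R e <;> simp [opS, opSStar, h]

/-- The operators of a branching system satisfy the defining relations of `L_K(𝒢)`. -/
theorem isLeavittFamily : G.IsLeavittFamily (S.opS K) (S.opSStar K) (S.opP K) where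
  p_empty := by
    refine LinearMap.ext fun φ => funext fun x => ?_
    simp [opP, S.D_empty]
  p_mul_p A C := by
    refine LinearMap.ext fun φ => funext fun x => ?_
    by_cases hA : x ∈ S.D A <;> by_cases hC : x ∈ S.D C <;> simp [opP, ← S.D_inter, hA, hC]
  p_union A C := by
    refine LinearMap.ext fun φ => funext fun x => ?_
    by_cases hA : x ∈ S.D A <;> by_cases hC : x ∈ S.D C <;>
      simp [opP, ← S.D_inter, ← S.D_union, hA, hC]
  p_source_mul_s e := by
    refine LinearMap.ext fun φ => funext fun x => ?_
    by_cases h : x ∈ S.R e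
    · have := S.R_subset e h
      simp [opS, opP, h, this]
    · simp [opS, opP, h]
  s_mul_p_range e := by
    refine LinearMap.ext fun φ => funext fun x => ?_
    by_cases h : x ∈ S.R e <;> simp [opS, opP, h]
  p_range_mul_sStar e := by
    refine LinearMap.ext fun φ => funext fun x => ?_
    by_cases h : x ∈ S.D (GenVertex.ofRange G e) <;> simp [opSStar, opP, h]
  sStar_mul_p_source e := by
    refine LinearMap.ext fun φ => funext fun x => ?_
    by_cases h : x ∈ S.D (GenVertex.ofRange G e)
    · have := S.R_subset e (S.f e ⟨x, h⟩).2
      simp [opSStar, opP, h, this]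
    · simp [opSStar, opP, h]
  sStar_mul_s_self e := by
    refine LinearMap.ext fun φ => funext fun x => ?_
    by_cases h : x ∈ S.D (GenVertex.ofRange G e) <;> simp [opS, opSStar, opP, h]
  sStar_mul_s_of_ne e e' hne := by
    refine LinearMap.ext fun φ => funext fun x => ?_
    by_cases h : x ∈ S.D (GenVertex.ofRange G e)
    · have h' : (S.f e ⟨x, h⟩ : X) ∉ S.R e' := fun h' => by
        have : (S.f e ⟨x, h⟩ : X) ∈ S.R e ∩ S.R e' := ⟨(S.f e ⟨x, h⟩).2, h'⟩
        rw [S.R_inter e e' hne] at this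
        exact this
      simp [opS, opSStar, h, h']
    · simp [opSStar, h]
  p_vertex v hv hne := by
    classical
    refine LinearMap.ext fun φ => funext fun x => ?_
    rw [LinearMap.sum_apply, Finset.sum_apply]
    simp only [opS_mul_opSStar_apply]
    change (if x ∈ S.D (GenVertex.vertex G v) then φ x else 0) = _
    rw [S.D_vertex v hv hne]
    by_cases hx : ∃ e, G.source e = v ∧ x ∈ S.R e
    · obtain ⟨e, he, hxe⟩ := hx
      rw [if_pos (Set.mem_iUnion₂.2 ⟨e, he, hxe⟩), Finset.sum_eq_single e, if_pos hxe]
      · intro e' _ hne'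
        refine if_neg fun hxe' => ?_
        have : x ∈ S.R e' ∩ S.R e := ⟨hxe', hxe⟩
        rw [S.R_inter e' e hne'] at this
        exact this
      · exact fun h => absurd (hv.mem_toFinset.2 he) h
    · rw [if_neg, Finset.sum_eq_zero]
      · exact fun e he => if_neg fun hxe => hx ⟨e, hv.mem_toFinset.1 he, hxe⟩
      · intro h
        obtain ⟨e, he, hxe⟩ := Set.mem_iUnion₂.1 h
        exact hx ⟨e, he, hxe⟩

/-- The representation of `L_K(𝒢)` on the module of all functions `X → K` induced by a branching
system: the unique one with `s_e ↦ S_e`, `s_e^* ↦ S_e^*`, `p_A ↦ P_A`. -/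
noncomputable def inducedRep : G.LeavittPathAlgebra K →ₙₐ[K] Module.End K (X → K) :=
  LeavittPathAlgebra.lift K (S.isLeavittFamily K)

theorem inducedRep_s (e : E) : S.inducedRep K (LeavittPathAlgebra.s G K e) = S.opS K e :=
  LeavittPathAlgebra.lift_s _ e

theorem inducedRep_sStar (e : E) :
    S.inducedRep K (LeavittPathAlgebra.sStar G K e) = S.opSStar K e :=
  LeavittPathAlgebra.lift_sStar _ e

theorem inducedRep_p (A : G.GenVertex) :
    S.inducedRep K (LeavittPathAlgebra.p G K A) = S.opP K A :=
  LeavittPathAlgebra.lift_p _ A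

end BranchingSystem

end Ultragraph

/-! Write π for the induced representation. The algebra is the union of an increasing chain: stage n
is spanned by the elements `s_α p_A s_β^*` with β of length at most n. By induction on n, the kernel
of π meets stage n only in 0.

Stage 0 is where Condition (L) enters. Multiplying an element by `p_v` turns it into a finite sum `∑
c_α s_α p_v`. If x lies in `D_{v}`, then π of `s_α p_v` sends the indicator of x to the indicator of
`f_α(x)`, or to 0 if α is no path to v. The coefficients can therefore be read off once the points
`f_α(x)` are distinct, which holds when no short nonempty closed path fixes x. Such a point exists
(`exists_aperiodic`): otherwise a single closed path would fix all of `D_{v}`, and an exit would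
contradict this. Since `D_A` may contain points outside every `D_{v}` with v in A, the passage from
vertices back to `p_A` is made inside the algebra (`mul_p_eq_zero`).

Let now y lie in stage n + 1 with π(y) = 0. Each `y s_e` lies in stage n and in the kernel, hence
vanishes, and this forces `y = y₀ - ∑_{e ∈ F} y₀ s_e s_e^*` with y₀ in stage 0 and F finite. At a
vertex that is a sink or emits an edge outside F, y₀ vanishes by the stage 0 argument. The remaining
vertices emit finitely many edges, all in F, so relation 4 gives `y₀ = ∑_{e ∈ F} y₀ s_e s_e^*` and y
= 0 (`eq_zero_of_eq_sub_sum`).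

There is no unit, so `s_α` for the empty path exists only as an operator. -/

namespace Ultragraph

/-! ### Paths as lists of edges -/

section Paths

variable {V E : Type*} (G : Ultragraph V E)

/-- The source of a list of edges, where the empty list is viewed as a path at `w`. -/
def pathSource : List E → V → V
  | [], w => w
  | e :: _, _ => G.source e

/-- The list of edges is a path whose range contains `w`; the empty path ends at every vertex. -/
def PathTo : List E → V → Prop
  | [], _ => True
  | e :: α, w => G.pathSource α w ∈ G.range e ∧ PathTo α w

variable {G}

theorem pathSource_append (α β : List E) (w : V) :
    G.pathSource (α ++ β) w = G.pathSource α (G.pathSource β w) := by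
  cases α <;> rfl

theorem pathTo_append {α β : List E} {w : V} :
    G.PathTo (α ++ β) w ↔ G.PathTo α (G.pathSource β w) ∧ G.PathTo β w := by
  induction α with
  | nil => simp [PathTo]
  | cons e α ih => simp [PathTo, ih, pathSource_append, and_assoc]

theorem PathTo.pathSource_drop_mem {α : List E} {w : V} (h : G.PathTo α w) {i : ℕ}
    (hi : i < α.length) : G.pathSource (α.drop (i + 1)) w ∈ G.range α[i] := by
  rw [← List.take_append_drop i α, pathTo_append, List.drop_eq_getElem_cons hi] at h
  exact h.2.1

theorem PathTo.take {α : List E} {w v : V} (h : G.PathTo α w) {i : ℕ}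
    (hi : i < α.length) (hv : v ∈ G.range α[i]) : G.PathTo (α.take (i + 1)) v := by
  rw [← List.take_append_drop i α, pathTo_append, List.drop_eq_getElem_cons hi] at h
  rw [← List.take_concat_get' α i hi, pathTo_append]
  exact ⟨h.1, hv, trivial⟩

/-- A nonempty path from `w` back to `w`, as a closed path. -/
theorem PathTo.isClosedPath {n : ℕ} {α : Fin (n + 1) → E} {w : V}
    (h : G.PathTo (List.ofFn α) w) (hw : G.pathSource (List.ofFn α) w = w) :
    G.IsClosedPath α := by
  have h0 : G.source (α 0) = w := by simpa [List.ofFn_succ, pathSource] using hw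
  constructor
  · intro i
    have := h.pathSource_drop_mem (i := i) (by simp)
    rw [List.drop_eq_getElem_cons (by simp)] at this
    simp only [pathSource, List.getElem_ofFn] at this
    exact this
  · have := h.pathSource_drop_mem (i := n) (by simp)
    rw [List.drop_of_length_le (by simp)] at this
    rw [h0]
    simp only [pathSource, List.getElem_ofFn] at this
    exact this

end Paths

/-! ### Dynamics of the branching system and aperiodic points -/

namespace BranchingSystem

variable {V E X : Type*} {G : Ultragraph V E} (S : G.BranchingSystem X)

/-- `x = f_α(z)`, where `f_α` is the composite of the maps `f_e` along the list `α`. -/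
def IsImage : List E → X → X → Prop
  | [], x, z => x = z
  | e :: α, x, z => ∃ h : x ∈ S.R e, IsImage α ((S.f e).symm ⟨x, h⟩) z

variable {S}

theorem isImage_append {α β : List E} {x z : X} :
    S.IsImage (α ++ β) x z ↔ ∃ y, S.IsImage α x y ∧ S.IsImage β y z := by
  induction α generalizing x with
  | nil => simp [IsImage]
  | cons e α ih =>
    simp only [List.cons_append, IsImage, ih]
    exact ⟨fun ⟨h, y, h₁, h₂⟩ => ⟨y, ⟨h, h₁⟩, h₂⟩, fun ⟨y, ⟨h, h₁⟩, h₂⟩ => ⟨h, y, h₁, h₂⟩⟩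

theorem eq_of_mem_R {e e' : E} {x : X} (h : x ∈ S.R e) (h' : x ∈ S.R e') : e = e' := by
  by_contra hne
  have : x ∈ S.R e ∩ S.R e' := ⟨h, h'⟩
  rw [S.R_inter e e' hne] at this
  exact this

/-- The sets `R_e` are disjoint, so a point determines the edges that can be stripped from it: two
addresses of x agree as far as both reach. -/
theorem IsImage.exists_append_cons {β γ : List E} {x y z : X} (h : S.IsImage β x y)
    (h' : S.IsImage γ x z) (hl : β.length < γ.length) :
    ∃ e δ, γ = β ++ e :: δ ∧ y ∈ S.R e := by
  induction β generalizing γ x with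
  | nil =>
    cases γ with
    | nil => simp at hl
    | cons e δ =>
      obtain ⟨h', -⟩ := h'
      cases h
      exact ⟨e, δ, rfl, h'⟩
  | cons e β ih =>
    cases γ with
    | nil => simp at hl
    | cons e' γ =>
      obtain ⟨h₁, h⟩ := h
      obtain ⟨h₁', h'⟩ := h'
      obtain rfl := eq_of_mem_R h₁ h₁'
      obtain ⟨e', δ, rfl, hy⟩ := ih h h' (by simpa using hl)
      exact ⟨e', δ, rfl, hy⟩

theorem IsImage.unique {β γ : List E} {x y z : X} (h : S.IsImage β x y)
    (h' : S.IsImage γ x z) (hl : β.length = γ.length) : β = γ ∧ y = z := by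
  induction β generalizing γ x with
  | nil =>
    cases γ with
    | nil => exact ⟨rfl, h.symm.trans h'⟩
    | cons e δ => simp at hl
  | cons e β ih =>
    cases γ with
    | nil => simp at hl
    | cons e' γ =>
      obtain ⟨h₁, h⟩ := h
      obtain ⟨h₁', h'⟩ := h'
      obtain rfl := eq_of_mem_R h₁ h₁'
      obtain ⟨rfl, hy⟩ := ih h h' (by simpa using hl)
      exact ⟨rfl, hy⟩

theorem D_mono {A B : G.GenVertex} (h : A.1 ⊆ B.1) : S.D A ⊆ S.D B := by
  have : A.inter B = A := Subtype.ext (Set.inter_eq_left.2 h)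
  rw [← this, ← S.D_inter]
  exact Set.inter_subset_right

theorem mem_D_range {v : V} {e : E} (h : v ∈ G.range e) {x : X}
    (hx : x ∈ S.D (GenVertex.vertex G v)) : x ∈ S.D (GenVertex.ofRange G e) :=
  D_mono (Set.singleton_subset_iff.2 h) hx

/-- For v outside A the intersection `D_{v} ∩ D_A` is `D_∅`, which is empty. -/
theorem mem_of_mem_D {v : V} {A : G.GenVertex} {x : X} (hx : x ∈ S.D (GenVertex.vertex G v))
    (hA : x ∈ S.D A) : v ∈ A.1 := by
  by_contra hv
  have h0 : (GenVertex.vertex G v).inter A = GenVertex.empty G :=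
    Subtype.ext (Set.singleton_inter_eq_empty.2 hv)
  have : x ∈ S.D (GenVertex.vertex G v) ∩ S.D A := ⟨hx, hA⟩
  rw [S.D_inter, h0, S.D_empty] at this
  exact this

theorem eq_of_mem_D {v w : V} {x : X} (hx : x ∈ S.D (GenVertex.vertex G v))
    (hw : x ∈ S.D (GenVertex.vertex G w)) : v = w := mem_of_mem_D hx hw

theorem exists_isImage {α : List E} {w : V} (h : G.PathTo α w) {z : X}
    (hz : z ∈ S.D (GenVertex.vertex G w)) :
    ∃ x, S.IsImage α x z ∧ x ∈ S.D (GenVertex.vertex G (G.pathSource α w)) := by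
  induction α with
  | nil => exact ⟨z, rfl, hz⟩
  | cons e α ih =>
    obtain ⟨y, hy, hyD⟩ := ih h.2
    let y' := S.f e ⟨y, mem_D_range h.1 hyD⟩
    exact ⟨y', ⟨y'.2, by simpa [y'] using hy⟩, S.R_subset e y'.2⟩

theorem IsImage.pathTo {α : List E} {w : V} {x z : X} (h : S.IsImage α x z)
    (hz : z ∈ S.D (GenVertex.vertex G w)) :
    G.PathTo α w ∧ x ∈ S.D (GenVertex.vertex G (G.pathSource α w)) := by
  induction α generalizing x with
  | nil =>
    cases h
    exact ⟨trivial, hz⟩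
  | cons e α ih =>
    obtain ⟨h₁, h⟩ := h
    obtain ⟨h₂, h₃⟩ := ih h
    exact ⟨⟨mem_of_mem_D h₃ ((S.f e).symm ⟨x, h₁⟩).2, h₂⟩, S.R_subset e h₁⟩

theorem D_vertex_nonempty (hD : ∀ A : G.GenVertex, A.carrier ≠ ∅ → S.D A ≠ ∅) (v : V) :
    (S.D (GenVertex.vertex G v)).Nonempty :=
  Set.nonempty_iff_ne_empty.2 (hD _ (Set.singleton_ne_empty v))

/-- Under Condition (L) no power of the shift is the identity on `D_{w}`. -/
theorem exists_not_isImage_self (hL : G.ConditionL)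
    (hD : ∀ A : G.GenVertex, A.carrier ≠ ∅ → S.D A ≠ ∅) (w : V) (n : ℕ) :
    ∃ x ∈ S.D (GenVertex.vertex G w), ∀ η : List E, η.length = n + 1 → ¬ S.IsImage η x x := by
  by_contra! hc
  obtain ⟨x, hx⟩ := D_vertex_nonempty hD w
  obtain ⟨η, hη, hηx⟩ := hc x hx
  obtain ⟨hpath, hsrc⟩ := hηx.pathTo hx
  have hw : G.pathSource η w = w := eq_of_mem_D hsrc hx
  obtain ⟨α, rfl⟩ : ∃ α : Fin (n + 1) → E, η = List.ofFn α :=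
    ⟨fun i => η.get (i.cast hη.symm), by
      rw [List.ofFn_congr hη.symm]
      exact (List.ofFn_get η).symm⟩
  -- The path α found at one point serves for all of `D_{w}`: the image `f_α(x')` lies in `D_{w}`
  -- again and is fixed by a path of the same length, so by uniqueness of addresses that path is α
  -- and `f_α(x') = x'`.
  have huniq : ∀ x' ∈ S.D (GenVertex.vertex G w), ∀ η', η'.length = n + 1 →
      S.IsImage η' x' x' → η' = List.ofFn α := by
    intro x' hx' η' hη' h'
    obtain ⟨x'', h₁, h₂⟩ := exists_isImage hpath hx'
    rw [hw] at h₂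
    obtain ⟨η'', hη'', h₃⟩ := hc x'' h₂
    obtain ⟨rfl, rfl⟩ := h₁.unique h₃ (by rw [hη, hη''])
    exact (h'.unique h₁ (by rw [hη, hη'])).1
  -- Lifting y along `α₀ … αᵢ` gives a point of `D_{w}`, which is fixed by α. Its address continues
  -- periodically, so y must lie in the next `R`.
  have key : ∀ (i : Fin (n + 1)) (v : V) (y : X), v ∈ G.range (α i) →
      y ∈ S.D (GenVertex.vertex G v) → y ∈ S.R (α (i + 1)) := by
    intro i v y hv hy
    have hi : (i : ℕ) < (List.ofFn α).length := by simpa using i.2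
    have hp := hpath.take hi (v := v) (by rwa [List.getElem_ofFn])
    obtain ⟨x', h₁, h₂⟩ := exists_isImage hp hy
    have hs : G.pathSource ((List.ofFn α).take (i + 1)) v = w := by
      rw [← hw]; simp [List.ofFn_succ, pathSource]
    rw [hs] at h₂
    obtain ⟨η', hη', h₃⟩ := hc x' h₂
    obtain rfl := huniq x' h₂ η' hη' h₃
    -- Two periods are needed so that the address is longer than `i + 1` even when i is the last
    -- index.
    have h₄ := isImage_append.2 ⟨x', h₃, h₃⟩
    obtain ⟨e, δ, h₅, h₆⟩ := h₁.exists_append_cons h₄ (by simp)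
    have hlen : ((List.ofFn α).take (i + 1)).length = i + 1 :=
      List.length_take_of_le (by simp; omega)
    have h₇ : (List.ofFn α ++ List.ofFn α)[(i : ℕ) + 1]? = some e := by
      rw [h₅, List.getElem?_append_right hlen.le, hlen]
      simp
    have h₈ : (List.ofFn α ++ List.ofFn α)[(i : ℕ) + 1]? = some (α (i + 1)) := by
      induction i using Fin.lastCases with
      | last => simp
      | cast j =>
        rw [List.getElem?_append_left (by simp), List.getElem?_eq_getElem (by simp),
          List.getElem_ofFn]
        congr 2
        simp [Fin.ext_iff]
    obtain rfl := Option.some.inj (h₇.symm.trans h₈)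
    exact h₆
  -- An exit edge yields a point of `R e` that also lies in `R (α (i + 1))`; a sink v yields a point
  -- of `D_{v}` that lies in the range of an edge map, so that edge would start at v.
  rcases hL n α (hpath.isClosedPath hw) with ⟨e, i, he, hne⟩ | ⟨v, i, hv, hvi⟩
  · obtain ⟨y₀, hy₀⟩ := Set.nonempty_iff_ne_empty.2 (hD (GenVertex.ofRange G e)
      (G.range_nonempty e).ne_empty)
    have hy := (S.f e ⟨y₀, hy₀⟩).2
    exact hne (eq_of_mem_R hy (key i _ _ he (S.R_subset e hy)))
  · obtain ⟨y, hy⟩ := D_vertex_nonempty hD v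
    exact hv _ (eq_of_mem_D (S.R_subset _ (key i v y hvi hy)) hy)

theorem IsImage.flatten_replicate {γ : List E} {x : X} (h : S.IsImage γ x x) (k : ℕ) :
    S.IsImage (List.replicate k γ).flatten x x := by
  induction k with
  | zero => rfl
  | succ k ih =>
    rw [List.replicate_succ, List.flatten_cons]
    exact isImage_append.2 ⟨x, h, ih⟩

/-- Under Condition (L) there is a point of `D_{w}` that no closed path of bounded length fixes. -/
theorem exists_aperiodic (hL : G.ConditionL)
    (hD : ∀ A : G.GenVertex, A.carrier ≠ ∅ → S.D A ≠ ∅) (w : V) (N : ℕ) :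
    ∃ x ∈ S.D (GenVertex.vertex G w), ∀ γ : List E, γ.length ≤ N → S.IsImage γ x x → γ = [] := by
  -- The length tested is `N!`: every nonempty γ of length at most N has a power of exactly that
  -- length, which fixes x if γ does.
  obtain ⟨x, hx, h⟩ := exists_not_isImage_self hL hD w (N.factorial - 1)
  refine ⟨x, hx, fun γ hγ hγx => ?_⟩
  by_contra hne
  have hpos := List.length_pos_of_ne_nil hne
  refine h _ ?_ (hγx.flatten_replicate (N.factorial / γ.length))
  have := N.factorial_pos
  simp [Nat.div_mul_cancel (Nat.dvd_factorial hpos hγ)]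
  omega

/-- For an aperiodic point `x` the points `f_α(x)` with `α` short are distinct. -/
theorem IsImage.eq_of_aperiodic {N : ℕ} {x : X}
    (hx : ∀ γ : List E, γ.length ≤ N → S.IsImage γ x x → γ = []) {α β : List E} {z : X}
    (hα : S.IsImage α z x) (hβ : S.IsImage β z x) (hαN : α.length ≤ N) (hβN : β.length ≤ N) :
    α = β := by
  wlog hle : α.length ≤ β.length generalizing α β
  · exact (this hβ hα hβN hαN (by omega)).symm
  rcases hle.lt_or_eq with hlt | heq
  · obtain ⟨e, δ, rfl, -⟩ := hα.exists_append_cons hβ hlt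
    obtain ⟨y, h₁, h₂⟩ := isImage_append.1 hβ
    obtain ⟨-, rfl⟩ := hα.unique h₁ rfl
    have := hx _ (by simp at hβN ⊢; omega) h₂
    simp at this
  · exact (hα.unique hβ heq).1

end BranchingSystem

end Ultragraph

namespace Ultragraph

/-! ### Computation with the generators -/

namespace LeavittPathAlgebra

variable {V E : Type*} {G : Ultragraph V E} {R : Type*} [CommRing R]

theorem p_mul_vertex_of_mem {A : G.GenVertex} {v : V} (h : v ∈ A.1) :
    p G R A * p G R (.vertex G v) = p G R (.vertex G v) := by
  rw [(isLeavittFamily G R).p_mul_p]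
  exact congrArg _ (Subtype.ext (Set.inter_eq_right.2 (Set.singleton_subset_iff.2 h)))

theorem p_mul_vertex_of_notMem {A : G.GenVertex} {v : V} (h : v ∉ A.1) :
    p G R A * p G R (.vertex G v) = 0 := by
  rw [(isLeavittFamily G R).p_mul_p, ← (isLeavittFamily G R).p_empty]
  exact congrArg _ (Subtype.ext (Set.inter_singleton_eq_empty.2 h))

theorem vertex_mul_self (v : V) :
    p G R (.vertex G v) * p G R (.vertex G v) = p G R (.vertex G v) :=
  p_mul_vertex_of_mem (A := .vertex G v) rfl

theorem vertex_mul_vertex_of_ne {v w : V} (h : w ≠ v) :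
    p G R (.vertex G v) * p G R (.vertex G w) = 0 :=
  p_mul_vertex_of_notMem (A := .vertex G v) h

theorem p_mul_comm (A B : G.GenVertex) : p G R A * p G R B = p G R B * p G R A := by
  rw [(isLeavittFamily G R).p_mul_p, (isLeavittFamily G R).p_mul_p]
  exact congrArg _ (Subtype.ext (Set.inter_comm _ _))

theorem p_mul_s_of_mem {A : G.GenVertex} {e : E} (h : G.source e ∈ A.1) :
    p G R A * s G R e = s G R e := by
  rw [← (isLeavittFamily G R).p_source_mul_s, ← mul_assoc, p_mul_vertex_of_mem h]

theorem p_mul_s_of_notMem {A : G.GenVertex} {e : E} (h : G.source e ∉ A.1) :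
    p G R A * s G R e = 0 := by
  rw [← (isLeavittFamily G R).p_source_mul_s, ← mul_assoc, p_mul_vertex_of_notMem h, zero_mul]

theorem sStar_mul_p_of_mem {A : G.GenVertex} {e : E} (h : G.source e ∈ A.1) :
    sStar G R e * p G R A = sStar G R e := by
  rw [← (isLeavittFamily G R).sStar_mul_p_source, mul_assoc, p_mul_comm, p_mul_vertex_of_mem h]

theorem sStar_mul_p_of_notMem {A : G.GenVertex} {e : E} (h : G.source e ∉ A.1) :
    sStar G R e * p G R A = 0 := by
  rw [← (isLeavittFamily G R).sStar_mul_p_source, mul_assoc, p_mul_comm,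
    p_mul_vertex_of_notMem h, mul_zero]

/-! ### Products along paths -/

section PathMul

variable (G R) in
/-- Left multiplication by `s_α = s_{α₁} ⋯ s_{αₙ}`, for a list of edges `α`. -/
noncomputable def pathMul : List E → G.LeavittPathAlgebra R →ₗ[R] G.LeavittPathAlgebra R
  | [] => LinearMap.id
  | e :: α => (LinearMap.mulLeft R (s G R e)).comp (pathMul α)

theorem pathMul_nil (b : G.LeavittPathAlgebra R) : pathMul G R [] b = b := rfl

theorem pathMul_cons (e : E) (α : List E) (b : G.LeavittPathAlgebra R) :
    pathMul G R (e :: α) b = s G R e * pathMul G R α b := rfl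

theorem pathMul_append (α β : List E) (b : G.LeavittPathAlgebra R) :
    pathMul G R (α ++ β) b = pathMul G R α (pathMul G R β b) := by
  induction α with
  | nil => rfl
  | cons e α ih => rw [List.cons_append, pathMul_cons, ih, pathMul_cons]

theorem pathMul_mul (α : List E) (b c : G.LeavittPathAlgebra R) :
    pathMul G R α b * c = pathMul G R α (b * c) := by
  induction α with
  | nil => rfl
  | cons e α ih => rw [pathMul_cons, mul_assoc, ih, pathMul_cons]

/-- The range of a nonempty path is a generalized vertex (empty if the list is no path). -/
theorem exists_range_of_ne_nil {α : List E} (h : α ≠ []) :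
    ∃ A : G.GenVertex, (∀ w, w ∈ A.1 ↔ G.PathTo α w) ∧
      ∀ b, pathMul G R α (p G R A * b) = pathMul G R α b := by
  induction α with
  | nil => exact absurd rfl h
  | cons e α ih =>
    cases α with
    | nil =>
      refine ⟨.ofRange G e, fun w => ⟨fun h => ⟨h, trivial⟩, fun h => h.1⟩, fun b => ?_⟩
      rw [pathMul_cons, pathMul_cons, pathMul_nil, pathMul_nil, ← mul_assoc,
        (isLeavittFamily G R).s_mul_p_range]
    | cons f α =>
      by_cases hf : G.source f ∈ G.range e
      · obtain ⟨A, hA, hb⟩ := ih (by simp)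
        refine ⟨A, fun w => (hA w).trans ⟨fun h => ⟨hf, h⟩, fun h => h.2⟩, fun b => ?_⟩
        rw [pathMul_cons, hb, ← pathMul_cons]
      · refine ⟨.empty G, fun w => ⟨fun h => h.elim, fun h => hf h.1⟩, fun b => ?_⟩
        have h0 : s G R e * s G R f = 0 := by
          rw [← (isLeavittFamily G R).s_mul_p_range, mul_assoc, p_mul_s_of_notMem hf, mul_zero]
        simp only [pathMul_cons, ← mul_assoc, h0, zero_mul]

theorem pathMul_vertex_mul_eq_zero {α : List E} {v : V} (h : ¬ G.PathTo α v)
    (b : G.LeavittPathAlgebra R) : pathMul G R α (p G R (.vertex G v) * b) = 0 := by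
  obtain ⟨A, hA, hb⟩ := exists_range_of_ne_nil (R := R) (G := G) (α := α)
    (by rintro rfl; exact h trivial)
  rw [← hb, ← mul_assoc, p_mul_vertex_of_notMem (fun hv => h ((hA v).1 hv)), zero_mul, map_zero]

theorem pathMul_vertex_eq_zero {α : List E} {v : V} (h : ¬ G.PathTo α v) :
    pathMul G R α (p G R (.vertex G v)) = 0 := by
  rw [← vertex_mul_self, pathMul_vertex_mul_eq_zero h]

end PathMul

/-! ### The commutative subalgebra spanned by the `p_A` -/

section VertexSpan

variable (G R) in
/-- The `R`-span of the idempotents `p_A`. -/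
noncomputable def vertexSpan : Submodule R (G.LeavittPathAlgebra R) :=
  Submodule.span R (Set.range (p G R))

theorem p_mem_vertexSpan (A : G.GenVertex) : p G R A ∈ vertexSpan G R :=
  Submodule.subset_span ⟨A, rfl⟩

theorem mul_mem_vertexSpan {q q' : G.LeavittPathAlgebra R} (h : q ∈ vertexSpan G R)
    (h' : q' ∈ vertexSpan G R) : q * q' ∈ vertexSpan G R := by
  refine Submodule.span_induction₂ (p := fun a b _ _ => a * b ∈ vertexSpan G R)
    ?_ ?_ ?_ ?_ ?_ ?_ ?_ h h'
  · rintro _ _ ⟨A, rfl⟩ ⟨B, rfl⟩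
    rw [(isLeavittFamily G R).p_mul_p]
    exact p_mem_vertexSpan _
  · intro y _
    rw [zero_mul]
    exact zero_mem _
  · intro y _
    rw [mul_zero]
    exact zero_mem _
  · intro x y z _ _ _ hx hy
    rw [add_mul]
    exact add_mem hx hy
  · intro x y z _ _ _ hx hy
    rw [mul_add]
    exact add_mem hx hy
  · intro r x y _ _ hx
    rw [smul_mul_assoc]
    exact Submodule.smul_mem _ _ hx
  · intro r x y _ _ hx
    rw [mul_smul_comm]
    exact Submodule.smul_mem _ _ hx

theorem p_mul_comm_of_mem {q : G.LeavittPathAlgebra R} (h : q ∈ vertexSpan G R)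
    (A : G.GenVertex) : p G R A * q = q * p G R A := by
  induction h using Submodule.span_induction with
  | mem x hx =>
    obtain ⟨B, rfl⟩ := hx
    exact p_mul_comm A B
  | zero => rw [mul_zero, zero_mul]
  | add x y _ _ hx hy => rw [mul_add, add_mul, hx, hy]
  | smul r x _ hx => rw [mul_smul_comm, smul_mul_assoc, hx]

theorem exists_mul_vertex_eq_smul {q : G.LeavittPathAlgebra R} (h : q ∈ vertexSpan G R)
    (v : V) : ∃ r : R, q * p G R (.vertex G v) = r • p G R (.vertex G v) := by
  induction h using Submodule.span_induction with
  | mem x hx =>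
    obtain ⟨B, rfl⟩ := hx
    by_cases hv : v ∈ B.1
    · exact ⟨1, by rw [p_mul_vertex_of_mem hv, one_smul]⟩
    · exact ⟨0, by rw [p_mul_vertex_of_notMem hv, zero_smul]⟩
  | zero => exact ⟨0, by rw [zero_mul, zero_smul]⟩
  | add x y _ _ hx hy =>
    obtain ⟨a, ha⟩ := hx
    obtain ⟨b, hb⟩ := hy
    exact ⟨a + b, by rw [add_mul, ha, hb, add_smul]⟩
  | smul r x _ hx =>
    obtain ⟨a, ha⟩ := hx
    exact ⟨r * a, by rw [smul_mul_assoc, ha, mul_smul]⟩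

/-- The difference `p_B - p_{B ∩ C}` stands for `B \ C`, which need not belong to `𝒢⁰`. The scalar r
collects the coefficients already known to be constant there. Each further term `b p_A` cuts `B \ C`
into the part inside A, where r becomes `r + b`, and the part outside A, where r stays. When no term
is left, r is the value at any vertex of the piece, so it is 0 or the piece is empty. -/
theorem linearCombination_mul_p_sub_eq_zero
    (hp : ∀ (v : V) (r : R), r • p G R (.vertex G v) = 0 → r = 0) (c : G.GenVertex →₀ R)
    (r : R) (B C : G.GenVertex)
    (h : ∀ v, v ∈ B.1 → v ∉ C.1 → r • p G R (.vertex G v) +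
      Finsupp.linearCombination R (p G R) c * p G R (.vertex G v) = 0) :
    r • (p G R B - p G R (B.inter C)) +
      Finsupp.linearCombination R (p G R) c * (p G R B - p G R (B.inter C)) = 0 := by
  induction c using Finsupp.induction generalizing r B C with
  | zero =>
    simp only [map_zero, zero_mul, add_zero] at h ⊢
    by_cases hv : ∃ v, v ∈ B.1 ∧ v ∉ C.1
    · obtain ⟨v, hB, hC⟩ := hv
      rw [hp v r (h v hB hC), zero_smul]
    · push Not at hv
      have : B.inter C = B := Subtype.ext (Set.inter_eq_left.2 hv)
      rw [this, sub_self, smul_zero]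
  | single_add A b f _ _ ih =>
    simp only [map_add, Finsupp.linearCombination_single, add_mul, smul_mul_assoc] at h ⊢
    have hset : B.inter (C.union A) = (B.inter C).union (B.inter A) :=
      Subtype.ext (Set.inter_union_distrib_left _ _ _)
    have hset' : (B.inter C).inter (B.inter A) = (B.inter A).inter C :=
      Subtype.ext (by simp only [GenVertex.inter]; grind)
    have hA₁ : p G R A * (p G R (B.inter A) - p G R ((B.inter A).inter C)) =
        p G R (B.inter A) - p G R ((B.inter A).inter C) := by
      rw [mul_sub, (isLeavittFamily G R).p_mul_p, (isLeavittFamily G R).p_mul_p]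
      congr 2 <;> exact Subtype.ext (by simp only [GenVertex.inter]; grind)
    have hA₂ : p G R A * (p G R B - p G R (B.inter (C.union A))) = 0 := by
      rw [mul_sub, (isLeavittFamily G R).p_mul_p, (isLeavittFamily G R).p_mul_p, sub_eq_zero]
      congr 1
      exact Subtype.ext (by simp only [GenVertex.inter, GenVertex.union]; grind)
    have hsplit : p G R B - p G R (B.inter C) =
        (p G R (B.inter A) - p G R ((B.inter A).inter C)) +
          (p G R B - p G R (B.inter (C.union A))) := by
      rw [hset, (isLeavittFamily G R).p_union, hset']
      abel
    have h₁ := ih (r + b) (B.inter A) C fun v hv hC => by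
      have := h v hv.1 hC
      rwa [p_mul_vertex_of_mem hv.2, ← add_assoc, ← add_smul] at this
    have h₂ := ih r B (C.union A) fun v hv hC => by
      have := h v hv (fun h => hC (Or.inl h))
      rwa [p_mul_vertex_of_notMem (fun h => hC (Or.inr h)), smul_zero, zero_add] at this
    rw [hsplit, mul_add (p G R A), hA₁, hA₂, add_zero]
    rw [add_smul] at h₁
    rw [← add_zero (0 : G.LeavittPathAlgebra R)]
    nth_rw 1 [← h₁]
    rw [← h₂]
    simp only [smul_add, mul_add]
    abel

/-- Elements of the span of the `p_A` are determined by their values at the vertices. -/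
theorem mul_p_eq_zero (hp : ∀ (v : V) (r : R), r • p G R (.vertex G v) = 0 → r = 0)
    {q : G.LeavittPathAlgebra R} (hq : q ∈ vertexSpan G R) {B : G.GenVertex}
    (h : ∀ v ∈ B.1, q * p G R (.vertex G v) = 0) : q * p G R B = 0 := by
  obtain ⟨c, rfl⟩ := Finsupp.mem_span_range_iff_exists_finsupp.1 hq
  have h0 : B.inter (.empty G) = .empty G := Subtype.ext (Set.inter_empty _)
  have := linearCombination_mul_p_sub_eq_zero hp c 0 B (.empty G) fun v hv _ => by
    rw [zero_smul, zero_add]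
    exact h v hv
  rwa [h0, (isLeavittFamily G R).p_empty, zero_smul, zero_add, sub_zero] at this

theorem exists_mul_p_eq_self {q : G.LeavittPathAlgebra R} (hq : q ∈ vertexSpan G R) :
    ∃ B : G.GenVertex, q * p G R B = q := by
  have hmono : ∀ {x : G.LeavittPathAlgebra R} {A B : G.GenVertex}, x * p G R A = x →
      A.1 ⊆ B.1 → x * p G R B = x := by
    intro x A B h hAB
    have : A.inter B = A := Subtype.ext (Set.inter_eq_left.2 hAB)
    rw [← h, mul_assoc, (isLeavittFamily G R).p_mul_p, this]
  induction hq using Submodule.span_induction with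
  | mem x hx =>
    obtain ⟨B, rfl⟩ := hx
    refine ⟨B, ?_⟩
    rw [(isLeavittFamily G R).p_mul_p]
    exact congrArg _ (Subtype.ext (Set.inter_self _))
  | zero => exact ⟨.empty G, zero_mul _⟩
  | add x y _ _ hx hy =>
    obtain ⟨A, ha⟩ := hx
    obtain ⟨B, hb⟩ := hy
    exact ⟨A.union B, by
      rw [add_mul, hmono ha Set.subset_union_left, hmono hb Set.subset_union_right]⟩
  | smul r x _ hx =>
    obtain ⟨A, ha⟩ := hx
    exact ⟨A, by rw [smul_mul_assoc, ha]⟩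

theorem pathMul_eq_zero (hp : ∀ (v : V) (r : R), r • p G R (.vertex G v) = 0 → r = 0)
    {q : G.LeavittPathAlgebra R} (hq : q ∈ vertexSpan G R) {α : List E}
    (h : ∀ v, G.PathTo α v → q * p G R (.vertex G v) = 0) : pathMul G R α q = 0 := by
  -- The empty path has no range to restrict to; a local unit `p_B` of q takes its place.
  rcases eq_or_ne α [] with rfl | hα
  · obtain ⟨B, hB⟩ := exists_mul_p_eq_self hq
    rw [← hB, mul_p_eq_zero hp hq fun v _ => h v trivial, map_zero]
  · obtain ⟨A, hA, hb⟩ := exists_range_of_ne_nil (R := R) (G := G) hα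
    rw [← hb, p_mul_comm_of_mem hq, mul_p_eq_zero hp hq fun v hv => h v ((hA v).1 hv), map_zero]

end VertexSpan

/-! ### The filtration by the length of the ghost path -/

section Filtration

variable (G R) in
/-- The span of the elements `s_α p_A`. -/
noncomputable def realSpan : Submodule R (G.LeavittPathAlgebra R) :=
  ⨆ α, (vertexSpan G R).map (pathMul G R α)

variable (G R) in
/-- The span of the elements `s_α p_A s_β^*` with `β` of length at most `n`. -/
noncomputable def ghostFiltration : ℕ → Submodule R (G.LeavittPathAlgebra R)
  | 0 => realSpan G R
  | n + 1 => realSpan G R ⊔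
      ⨆ e, (ghostFiltration n).map (LinearMap.mulRight R (sStar G R e))

theorem pathMul_mem_realSpan (α : List E) {q : G.LeavittPathAlgebra R}
    (h : q ∈ vertexSpan G R) : pathMul G R α q ∈ realSpan G R :=
  Submodule.mem_iSup_of_mem α ⟨q, h, rfl⟩

theorem exists_eq_sum_of_mem_realSpan {y : G.LeavittPathAlgebra R} (h : y ∈ realSpan G R) :
    ∃ (t : Finset (List E)) (q : List E → G.LeavittPathAlgebra R),
      (∀ α, q α ∈ vertexSpan G R) ∧ y = ∑ α ∈ t, pathMul G R α (q α) := by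
  obtain ⟨f, hf, rfl⟩ := (Submodule.mem_iSup_iff_exists_finsupp _ _).1 h
  choose q hq hqf using hf
  exact ⟨f.support, q, hq, Finset.sum_congr rfl fun α _ => (hqf α).symm⟩

theorem realSpan_mul_mem {M : Submodule R (G.LeavittPathAlgebra R)}
    {b : G.LeavittPathAlgebra R} (h : ∀ α A, pathMul G R α (p G R A * b) ∈ M)
    {y : G.LeavittPathAlgebra R} (hy : y ∈ realSpan G R) : y * b ∈ M := by
  obtain ⟨t, q, hq, rfl⟩ := exists_eq_sum_of_mem_realSpan hy
  rw [Finset.sum_mul]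
  refine Submodule.sum_mem _ fun α _ => ?_
  rw [pathMul_mul]
  have hα := hq α
  generalize q α = x at hα
  induction hα using Submodule.span_induction with
  | mem x hx =>
    obtain ⟨A, rfl⟩ := hx
    exact h α A
  | zero =>
    rw [zero_mul, map_zero]
    exact zero_mem _
  | add x y _ _ hx hy =>
    rw [add_mul, map_add]
    exact add_mem hx hy
  | smul r x _ hx =>
    rw [smul_mul_assoc, map_smul]
    exact Submodule.smul_mem _ _ hx

theorem realSpan_mul_p_mem {y : G.LeavittPathAlgebra R} (hy : y ∈ realSpan G R)
    (A : G.GenVertex) : y * p G R A ∈ realSpan G R :=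
  realSpan_mul_mem (fun α B => pathMul_mem_realSpan α
    (mul_mem_vertexSpan (p_mem_vertexSpan B) (p_mem_vertexSpan A))) hy

theorem realSpan_mul_s_mem {y : G.LeavittPathAlgebra R} (hy : y ∈ realSpan G R)
    (e : E) : y * s G R e ∈ realSpan G R := by
  refine realSpan_mul_mem (fun α A => ?_) hy
  by_cases h : G.source e ∈ A.1
  · rw [p_mul_s_of_mem h, ← (isLeavittFamily G R).s_mul_p_range, ← pathMul_nil (p G R _),
      ← pathMul_cons, ← pathMul_append]
    exact pathMul_mem_realSpan _ (p_mem_vertexSpan _)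
  · rw [p_mul_s_of_notMem h, map_zero]
    exact zero_mem _

theorem realSpan_le_ghostFiltration (n : ℕ) : realSpan G R ≤ ghostFiltration G R n := by
  cases n with
  | zero => exact le_rfl
  | succ n => exact le_sup_left

theorem mul_sStar_mem_ghostFiltration {n : ℕ} {y : G.LeavittPathAlgebra R}
    (hy : y ∈ ghostFiltration G R n) (e : E) :
    y * sStar G R e ∈ ghostFiltration G R (n + 1) :=
  Submodule.mem_sup_right (Submodule.mem_iSup_of_mem e ⟨y, hy, rfl⟩)

theorem exists_eq_add_sum_of_mem_ghostFiltration {n : ℕ} {y : G.LeavittPathAlgebra R}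
    (hy : y ∈ ghostFiltration G R (n + 1)) :
    ∃ y₀ ∈ realSpan G R, ∃ (F : Finset E) (z : E → G.LeavittPathAlgebra R),
      (∀ e, z e ∈ ghostFiltration G R n) ∧ y = y₀ + ∑ e ∈ F, z e * sStar G R e := by
  obtain ⟨y₀, hy₀, y₁, hy₁, rfl⟩ := Submodule.mem_sup.1 hy
  obtain ⟨f, hf, rfl⟩ := (Submodule.mem_iSup_iff_exists_finsupp _ _).1 hy₁
  choose z hz hzf using hf
  exact ⟨y₀, hy₀, f.support, z, hz, congrArg _ (Finset.sum_congr rfl fun e _ => (hzf e).symm)⟩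

theorem ghostFiltration_mono : Monotone (ghostFiltration G R) := by
  refine monotone_nat_of_le_succ fun n => ?_
  induction n with
  | zero => exact le_sup_left
  | succ n ih => exact sup_le_sup_left (iSup_mono fun e => Submodule.map_mono ih) _

theorem ghostFiltration_mul_p_mem {n : ℕ} {y : G.LeavittPathAlgebra R}
    (hy : y ∈ ghostFiltration G R n) (A : G.GenVertex) :
    y * p G R A ∈ ghostFiltration G R n := by
  cases n with
  | zero => exact realSpan_mul_p_mem hy A
  | succ n =>
    obtain ⟨y₀, hy₀, F, z, hz, rfl⟩ := exists_eq_add_sum_of_mem_ghostFiltration hy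
    rw [add_mul, Finset.sum_mul]
    refine add_mem (realSpan_le_ghostFiltration _ (realSpan_mul_p_mem hy₀ A))
      (Submodule.sum_mem _ fun e _ => ?_)
    rw [mul_assoc]
    by_cases h : G.source e ∈ A.1
    · rw [sStar_mul_p_of_mem h]
      exact mul_sStar_mem_ghostFiltration (hz e) e
    · rw [sStar_mul_p_of_notMem h, mul_zero]
      exact zero_mem _

/-- The factor `s_f` cancels the last ghost edge, since `s_e^* s_f` is `p_{r(e)}` or 0. This lowers
the degree in the main induction. -/
theorem ghostFiltration_mul_s_mem {n : ℕ} {y : G.LeavittPathAlgebra R}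
    (hy : y ∈ ghostFiltration G R (n + 1)) (f : E) :
    y * s G R f ∈ ghostFiltration G R n := by
  obtain ⟨y₀, hy₀, F, z, hz, rfl⟩ := exists_eq_add_sum_of_mem_ghostFiltration hy
  rw [add_mul, Finset.sum_mul]
  refine add_mem (realSpan_le_ghostFiltration _ (realSpan_mul_s_mem hy₀ f))
    (Submodule.sum_mem _ fun e _ => ?_)
  rw [mul_assoc]
  rcases eq_or_ne e f with rfl | h
  · rw [(isLeavittFamily G R).sStar_mul_s_self]
    exact ghostFiltration_mul_p_mem (hz e) _
  · rw [(isLeavittFamily G R).sStar_mul_s_of_ne e f h, mul_zero]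
    exact zero_mem _

/-- A subspace that contains the generators and is closed under right multiplication by them is
the whole algebra. -/
theorem eq_top_of_mul_mem {M : Submodule R (G.LeavittPathAlgebra R)}
    (h : ∀ x, mk G (FreeAlg.gen R x) ∈ M)
    (hmul : ∀ y ∈ M, ∀ x, y * mk G (FreeAlg.gen R x) ∈ M) : M = ⊤ := by
  have hw : ∀ w : FreeSemigroup G.Gen, mk G (MonoidAlgebra.single w (1 : R)) ∈ M ∧
      ∀ y ∈ M, y * mk G (MonoidAlgebra.single w (1 : R)) ∈ M := by
    intro w
    induction w using FreeSemigroup.recOnMul with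
    | ih1 x => exact ⟨h x, fun y hy => hmul y hy x⟩
    | ih2 x w _ ih =>
      have : (MonoidAlgebra.single (FreeSemigroup.of x * w) (1 : R)) =
          FreeAlg.gen R x * MonoidAlgebra.single w 1 := by
        rw [FreeAlg.gen, MonoidAlgebra.single_mul_single, one_mul]
      rw [this, mk_mul]
      refine ⟨ih.2 _ (h x), fun y hy => ?_⟩
      rw [← mul_assoc]
      exact ih.2 _ (hmul y hy x)
  refine Submodule.eq_top_iff'.2 fun y => ?_
  obtain ⟨y, rfl⟩ := mk_surjective y
  induction y using MonoidAlgebra.induction_linear with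
  | zero => exact zero_mem _
  | add x y hx hy =>
    rw [mk_add]
    exact add_mem hx hy
  | single w r =>
    have : MonoidAlgebra.single w r = r • MonoidAlgebra.single w (1 : R) := by simp
    rw [this, mk_smul]
    exact Submodule.smul_mem _ _ (hw w).1

theorem exists_mem_ghostFiltration (y : G.LeavittPathAlgebra R) :
    ∃ n, y ∈ ghostFiltration G R n := by
  have hdir := ghostFiltration_mono (G := G) (R := R).directed_le
  have : ⨆ n, ghostFiltration G R n = ⊤ := by
    have hmem : ∀ {x}, x ∈ ⨆ n, ghostFiltration G R n ↔ ∃ n, x ∈ ghostFiltration G R n :=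
      Submodule.mem_iSup_of_directed _ hdir
    have hp : ∀ A, p G R A ∈ realSpan G R := fun A =>
      pathMul_mem_realSpan [] (p_mem_vertexSpan A)
    refine eq_top_of_mul_mem (fun x => hmem.2 ?_) fun y hy x => hmem.2 ?_
    · cases x with
      | s e =>
        refine ⟨0, ?_⟩
        change s G R e ∈ _
        rw [← (isLeavittFamily G R).p_source_mul_s]
        exact realSpan_mul_s_mem (hp _) e
      | sStar e =>
        refine ⟨1, ?_⟩
        change sStar G R e ∈ _
        rw [← (isLeavittFamily G R).p_range_mul_sStar]
        exact mul_sStar_mem_ghostFiltration (n := 0) (hp _) e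
      | p A => exact ⟨0, hp A⟩
    · obtain ⟨n, hn⟩ := hmem.1 hy
      cases x with
      | s e => exact ⟨n, ghostFiltration_mul_s_mem (ghostFiltration_mono n.le_succ hn) e⟩
      | sStar e => exact ⟨n + 1, mul_sStar_mem_ghostFiltration hn e⟩
      | p A => exact ⟨n, ghostFiltration_mul_p_mem hn A⟩
  exact (Submodule.mem_iSup_of_directed _ hdir).1 (this ▸ Submodule.mem_top)

end Filtration

end LeavittPathAlgebra

end Ultragraph

namespace Ultragraph

/-! ### Injectivity of the induced representation -/

namespace BranchingSystem

open LeavittPathAlgebra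

variable {V E X R : Type*} [CommRing R] {G : Ultragraph V E} {S : G.BranchingSystem X}

-- The element `s_α p_w` carries the indicator of x to that of `f_α(x)`, which makes coefficients
-- visible.
open Classical in
theorem inducedRep_pathMul_vertex_single {w : V} {x : X}
    (hx : x ∈ S.D (GenVertex.vertex G w)) (α : List E) (z : X) :
    S.inducedRep R (pathMul G R α (p G R (.vertex G w))) (Pi.single x 1) z =
      if S.IsImage α z x then 1 else 0 := by
  induction α generalizing z with
  | nil =>
    rw [pathMul_nil, inducedRep_p]
    change (if z ∈ S.D (.vertex G w) then (Pi.single x 1 : X → R) z else 0) =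
      if z = x then 1 else 0
    by_cases hz : z = x
    · subst hz
      simp [hx]
    · simp [hz]
  | cons e α ih =>
    rw [pathMul_cons, map_mul, inducedRep_s]
    change (if h : z ∈ S.R e then S.inducedRep R (pathMul G R α (p G R (.vertex G w)))
      (Pi.single x 1) ((S.f e).symm ⟨z, h⟩) else 0) = _
    by_cases h : z ∈ S.R e <;> simp [IsImage, h, ih]

/-- Under Condition (L) the induced representation is injective on combinations of the elements
`s_α p_w`. -/
theorem coeff_eq_zero_of_inducedRep_eq_zero (hL : G.ConditionL)
    (hD : ∀ A : G.GenVertex, A.carrier ≠ ∅ → S.D A ≠ ∅) {w : V} {ι : Type*} {t : Finset ι}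
    {a : ι → List E} (ha : Function.Injective a) {c : ι → R}
    (h : S.inducedRep R (∑ i ∈ t, c i • pathMul G R (a i) (p G R (.vertex G w))) = 0)
    {i : ι} (hi : i ∈ t) (hiw : G.PathTo (a i) w) : c i = 0 := by
  classical
  -- With the longest path of the sum as bound, only the term i contributes at the point z, the
  -- image of x along `a i`.
  obtain ⟨x, hx, hper⟩ := exists_aperiodic (S := S) hL hD w (t.sup fun i => (a i).length)
  obtain ⟨z, hz, -⟩ := exists_isImage hiw hx
  have h' := congrFun (LinearMap.congr_fun h (Pi.single x 1)) z
  rw [map_sum, LinearMap.sum_apply, Finset.sum_apply, Finset.sum_eq_single i] at h'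
  · rw [map_smul, LinearMap.smul_apply, Pi.smul_apply,
      inducedRep_pathMul_vertex_single hx, if_pos hz] at h'
    simpa using h'
  · intro j hj hji
    rw [map_smul, LinearMap.smul_apply, Pi.smul_apply,
      inducedRep_pathMul_vertex_single hx, if_neg, smul_zero]
    intro hz'
    exact hji (ha (hz'.eq_of_aperiodic hper hz (Finset.le_sup (f := fun i => (a i).length) hj)
      (Finset.le_sup (f := fun i => (a i).length) hi)))
  · exact fun h => absurd hi h

theorem eq_zero_of_smul_vertex_eq_zero
    (hD : ∀ A : G.GenVertex, A.carrier ≠ ∅ → S.D A ≠ ∅) (v : V) (r : R)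
    (h : r • p G R (.vertex G v) = 0) : r = 0 := by
  classical
  obtain ⟨x, hx⟩ := D_vertex_nonempty hD v
  have h' := congrFun (LinearMap.congr_fun (congrArg (S.inducedRep R) h) (Pi.single x 1)) x
  rw [map_smul, LinearMap.smul_apply, Pi.smul_apply, ← pathMul_nil (p G R _),
    inducedRep_pathMul_vertex_single hx, if_pos (show S.IsImage [] x x from rfl)] at h'
  simpa using h'

theorem eq_zero_of_mem_realSpan (hL : G.ConditionL)
    (hD : ∀ A : G.GenVertex, A.carrier ≠ ∅ → S.D A ≠ ∅) {y : G.LeavittPathAlgebra R}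
    (hy : y ∈ realSpan G R)
    (h : ∀ v, S.inducedRep R (y * p G R (.vertex G v)) = 0) : y = 0 := by
  obtain ⟨t, q, hq, rfl⟩ := exists_eq_sum_of_mem_realSpan hy
  refine Finset.sum_eq_zero fun α hα =>
    pathMul_eq_zero (eq_zero_of_smul_vertex_eq_zero hD) (hq α) fun v hv => ?_
  choose c hc using fun α => exists_mul_vertex_eq_smul (hq α) v
  have h' := h v
  simp only [Finset.sum_mul, pathMul_mul, hc, map_smul] at h'
  rw [hc, coeff_eq_zero_of_inducedRep_eq_zero hL hD (t := t) (a := id) (c := c) (w := v)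
    Function.injective_id (by simpa only [id, map_smul] using h') hα hv, zero_smul]

/-- Appending e is injective on paths, so for u in `r(e)` the coefficients of `y s_e p_u` are those
of `y p_{s(e)}`. -/
theorem mul_vertex_eq_zero_of_mem_realSpan (hL : G.ConditionL)
    (hD : ∀ A : G.GenVertex, A.carrier ≠ ∅ → S.D A ≠ ∅) {y : G.LeavittPathAlgebra R}
    (hy : y ∈ realSpan G R) {e : E} (h : S.inducedRep R (y * s G R e) = 0) :
    y * p G R (.vertex G (G.source e)) = 0 := by
  obtain ⟨t, q, hq, rfl⟩ := exists_eq_sum_of_mem_realSpan hy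
  choose c hc using fun α => exists_mul_vertex_eq_smul (hq α) (G.source e)
  obtain ⟨u, hu⟩ := G.range_nonempty e
  have h' : S.inducedRep R ((∑ α ∈ t, pathMul G R α (q α)) *
      (p G R (.vertex G (G.source e)) * s G R e * p G R (.vertex G u))) = 0 := by
    rw [(LeavittPathAlgebra.isLeavittFamily G R).p_source_mul_s, ← mul_assoc, map_mul, h, zero_mul]
  simp only [Finset.sum_mul, pathMul_mul, hc]
  refine Finset.sum_eq_zero fun α hα => ?_
  by_cases hv : G.PathTo α (G.source e)
  · rw [coeff_eq_zero_of_inducedRep_eq_zero hL hD (t := t) (a := (· ++ [e])) (c := c) (w := u)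
      (List.append_left_injective [e]) ?_ hα (pathTo_append.2 ⟨hv, hu, trivial⟩), zero_smul,
      map_zero]
    rw [← h', Finset.sum_mul]
    refine congrArg _ (Finset.sum_congr rfl fun β _ => ?_)
    rw [pathMul_mul, ← mul_assoc, ← mul_assoc, hc, smul_mul_assoc, smul_mul_assoc,
      (LeavittPathAlgebra.isLeavittFamily G R).p_source_mul_s, map_smul, pathMul_append,
      pathMul_cons, pathMul_nil]
  · rw [map_smul, pathMul_vertex_eq_zero hv, smul_zero]

theorem eq_zero_of_eq_sub_sum (hL : G.ConditionL)
    (hD : ∀ A : G.GenVertex, A.carrier ≠ ∅ → S.D A ≠ ∅) {y y₀ : G.LeavittPathAlgebra R}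
    (hy₀ : y₀ ∈ realSpan G R) {F : Finset E}
    (hy : y = y₀ - ∑ e ∈ F, y₀ * s G R e * sStar G R e) (h : S.inducedRep R y = 0) : y = 0 := by
  classical
  -- W consists of the vertices that emit at least one edge and only edges of F: exactly where
  -- relation 4 can be applied within F.
  let W : Finset V := (F.image G.source).filter fun v => ∀ e, G.source e = v → e ∈ F
  let u : G.LeavittPathAlgebra R := ∑ v ∈ W, p G R (.vertex G v)
  have hu : ∀ v ∈ W, u * p G R (.vertex G v) = p G R (.vertex G v) := by
    intro v hv
    rw [Finset.sum_mul, Finset.sum_eq_single v (fun w _ hw => vertex_mul_vertex_of_ne hw.symm)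
      (fun h => absurd hv h), vertex_mul_self]
  have hu' : ∀ v ∉ W, u * p G R (.vertex G v) = 0 := by
    intro v hv
    rw [Finset.sum_mul]
    exact Finset.sum_eq_zero fun w hw =>
      vertex_mul_vertex_of_ne (by rintro rfl; exact hv hw)
  have hzero : ∀ e, G.source e ∉ W → y₀ * p G R (.vertex G (G.source e)) = 0 := by
    intro e he
    -- An edge f outside F is orthogonal to the whole correction sum, so `y s_f = y₀ s_f` lies in
    -- the kernel.
    obtain ⟨f, hf, hfF⟩ : ∃ f, G.source f = G.source e ∧ f ∉ F := by
      by_contra! hc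
      exact he (Finset.mem_filter.2 ⟨Finset.mem_image_of_mem _ (hc e rfl), hc⟩)
    rw [← hf]
    refine mul_vertex_eq_zero_of_mem_realSpan (S := S) hL hD hy₀ ?_
    have : y * s G R f = y₀ * s G R f := by
      rw [hy, sub_mul, Finset.sum_mul, Finset.sum_eq_zero, sub_zero]
      intro e he
      rw [mul_assoc, (LeavittPathAlgebra.isLeavittFamily G R).sStar_mul_s_of_ne e f
        (by rintro rfl; exact hfF he), mul_zero]
    rw [← this, map_mul, h, zero_mul]
  -- Tested vertex by vertex: u acts as the identity on W and as 0 elsewhere. Outside W, either `y₀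
  -- p_v = 0` already or v is a sink, where `y₀ p_v = y p_v` lies in the kernel.
  have hsub : y₀ - y₀ * u = 0 := by
    refine eq_zero_of_mem_realSpan (S := S) hL hD (sub_mem hy₀ ?_) fun v => ?_
    · rw [Finset.mul_sum]
      exact Submodule.sum_mem _ fun v _ => realSpan_mul_p_mem hy₀ _
    rw [sub_mul, mul_assoc]
    by_cases hv : v ∈ W
    · rw [hu v hv, sub_self, map_zero]
    rw [hu' v hv, mul_zero, sub_zero]
    by_cases hs : ∃ e, G.source e = v
    · obtain ⟨e, rfl⟩ := hs
      rw [hzero e hv, map_zero]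
    · have : y * p G R (.vertex G v) = y₀ * p G R (.vertex G v) := by
        rw [hy, sub_mul, Finset.sum_mul, Finset.sum_eq_zero, sub_zero]
        intro e he
        rw [mul_assoc, sStar_mul_p_of_notMem (A := .vertex G v) (fun h => hs ⟨e, h⟩), mul_zero]
      rw [← this, map_mul, h, zero_mul]
  -- Edges of F with source outside W contribute 0; the others, grouped by source, add up to the
  -- `p_v` by relation 4.
  have hsum : y₀ * u = ∑ e ∈ F, y₀ * s G R e * sStar G R e := by
    rw [← Finset.sum_filter_add_sum_filter_not F (fun e => G.source e ∈ W)]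
    have : ∑ e ∈ F with G.source e ∉ W, y₀ * s G R e * sStar G R e = 0 := by
      refine Finset.sum_eq_zero fun e he => ?_
      rw [← (LeavittPathAlgebra.isLeavittFamily G R).p_source_mul_s, ← mul_assoc,
        hzero e (Finset.mem_filter.1 he).2, zero_mul, zero_mul]
    rw [this, add_zero, Finset.mul_sum,
      ← Finset.sum_fiberwise_of_maps_to (fun e he => (Finset.mem_filter.1 he).2)]
    refine Finset.sum_congr rfl fun v hv => ?_
    obtain ⟨hvF, hvall⟩ := Finset.mem_filter.1 hv
    obtain ⟨e, he, hev⟩ := Finset.mem_image.1 hvF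
    have hfin : {e | G.source e = v}.Finite := F.finite_toSet.subset fun e he => hvall e he
    rw [(LeavittPathAlgebra.isLeavittFamily G R).p_vertex v hfin ⟨e, hev⟩, Finset.mul_sum]
    refine Finset.sum_congr ?_ fun e _ => (mul_assoc _ _ _).symm
    ext e
    simp only [Set.Finite.mem_toFinset, Set.mem_ofPred_eq, Finset.mem_filter]
    exact ⟨fun h => ⟨⟨hvall e h, h ▸ hv⟩, h⟩, fun h => h.2⟩
  rw [hy, ← hsum, hsub]

theorem eq_zero_of_mem_ghostFiltration (hL : G.ConditionL)
    (hD : ∀ A : G.GenVertex, A.carrier ≠ ∅ → S.D A ≠ ∅) {n : ℕ} {y : G.LeavittPathAlgebra R}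
    (hy : y ∈ ghostFiltration G R n) (h : S.inducedRep R y = 0) : y = 0 := by
  induction n generalizing y with
  | zero =>
    exact eq_zero_of_mem_realSpan (S := S) hL hD hy fun v => by rw [map_mul, h, zero_mul]
  | succ n ih =>
    have hys : ∀ e, y * s G R e = 0 := fun e =>
      ih (ghostFiltration_mul_s_mem hy e) (by rw [map_mul, h, zero_mul])
    obtain ⟨y₀, hy₀, F, z, -, rfl⟩ := exists_eq_add_sum_of_mem_ghostFiltration hy
    refine eq_zero_of_eq_sub_sum (S := S) hL hD hy₀ (F := F) ?_ h
    rw [sub_eq_add_neg, ← Finset.sum_neg_distrib]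
    congr 1
    refine Finset.sum_congr rfl fun e he => ?_
    -- Since `y s_e = 0`, orthogonality of the ghost edges leaves `y₀ s_e + z_e p_{r(e)} = 0`, which
    -- expresses `z_e s_e^*` through y₀.
    have := hys e
    rw [add_mul, Finset.sum_mul, Finset.sum_eq_single e (fun f _ hf => by
      rw [mul_assoc, (LeavittPathAlgebra.isLeavittFamily G R).sStar_mul_s_of_ne f e hf, mul_zero])
      (fun h => absurd he h), mul_assoc,
      (LeavittPathAlgebra.isLeavittFamily G R).sStar_mul_s_self] at this
    rw [← neg_mul, neg_eq_of_add_eq_zero_right this, mul_assoc,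
      (LeavittPathAlgebra.isLeavittFamily G R).p_range_mul_sStar]

end BranchingSystem

end Ultragraph

/-- If the ultragraph `G` satisfies Condition (L), then for every branching system with `D_A ≠ ∅`
for all nonempty `A ∈ 𝒢⁰` the induced representation of `L_R(G)` is faithful. -/
theorem mainTheorem5 {V E X R : Type*} [CommRing R] (G : Ultragraph V E) (hL : G.ConditionL)
    (S : G.BranchingSystem X)
    (hD : ∀ A : G.GenVertex, A.carrier ≠ ∅ → S.D A ≠ ∅) :
    Function.Injective (S.inducedRep R) := by
  refine (injective_iff_map_eq_zero (S.inducedRep R)).2 fun y hy => ?_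
  obtain ⟨n, hn⟩ := Ultragraph.LeavittPathAlgebra.exists_mem_ghostFiltration y
  exact Ultragraph.BranchingSystem.eq_zero_of_mem_ghostFiltration hL hD hn hy
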